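/- **Theorem 4.2.** Let $\gamma>8$, $C_0\ge 4$ and $0\le q<r$ be real numbers. There are constants $C_5,C_6>0$, depending only on $\gamma,C_0,q,r$, such that the following holds for all integers $n,p\ge1$ and all $R>0$ with $\gamma\log p<n$ and $\tau:=2C_0\sqrt{\gamma\log p/n}\le 1$. Let $\mathcal G_q(R)$ be the set of positive semidefinite $p\times p$ real matrices $\Sigma=(\sigma_{ij})$ with $\sigma_{ii}=1$ for all $i$ and $\max_{i}\sum_{j=1}^p|\sigma_{ij}|^q\le R$ (with $0^0:=0$, so that for $q=0$ nonzero entries are counted), and put $\ell_r(M)=\max_i\sum_{j}|m_{ij}|^r$ for a $p\times p$ matrix $M=(m_{ij})$. Let $\Sigma\in\mathcal G_q(R)$, let $X_1,\dots,X_n$ be i.i.d. $\mathcal N(0,\Sigma)$ random vectors, and let $\hat\Sigma=(\hat\sigma_{ij})=\frac1n\sum_{k=1}^nX_kX_k^\top$. Let $\tilde\Sigma_\tau=(\tilde\sigma_{ij})$ be the thresholded matrix with $\tilde\sigma_{ij}=\hat\sigma_{ij}\mathbf 1\{|\hat\sigma_{ij}|>\tau\}$ for $i\ne j$ and $\tilde\sigma_{ii}=\hat\sigma_{ii}$.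 Then $$\mathbb E\big[(\ell_r(\tilde\Sigma_\tau)-\ell_r(\Sigma))^2\big]\le C_5\,\tilde\psi_{n,p}(q,R)+C_6\,p^{4-\gamma/2},$$ where $$\tilde\psi_{n,p}(q,R)=\begin{cases}\dfrac{R^2\log p}{n}&\text{if } q<\max\{r-1,0\},\\[2mm] R^2\Big(\dfrac{\gamma\log p}{n}\Big)^{r-q}&\text{if } q\ge\max\{r-1,0\}.\end{cases}$$ In particular the expectation on the left is finite. The same holds, with the same constants, when the diagonal entries are thresholded as well, i.e. for the estimator $\max_i\sum_{j}|\hat\sigma_{ij}|^r\,\mathbf 1\{|\hat\sigma_{ij}|>\tau\}$. -/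

import Mathlib

open MeasureTheory ProbabilityTheory

noncomputable section

/-- `|x| ^ q` with the sparsity convention `|0| ^ 0 = 0`, so that for `q = 0` a sum of such terms
counts nonzero entries. -/
def absPow (x q : ℝ) : ℝ := if x = 0 then 0 else |x| ^ q

/-- The class `𝒢_q(R)` of positive semidefinite `p × p` matrices with unit diagonal, all of whose
rows satisfy `∑ j, |σ_ij| ^ q ≤ R`. -/
def covClassG (p : ℕ) (q R : ℝ) : Set (Matrix (Fin p) (Fin p) ℝ) :=
  {S | S.PosSemidef ∧ (∀ i, ∑ j, absPow (S i j) q ≤ R) ∧ ∀ i, S i i = 1}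

/-- The functional `ℓ_r(M) = max_i ∑ j, |M_ij| ^ r`. -/
def lrFunctional {p : ℕ} (r : ℝ) (M : Matrix (Fin p) (Fin p) ℝ) : ℝ :=
  ⨆ i, ∑ j, |M i j| ^ r

/-- The empirical covariance matrix `(1/n) ∑ k, X_k X_kᵀ` of `n` centred observations. -/
def empCov {n p : ℕ} (x : Fin n → EuclideanSpace ℝ (Fin p)) : Matrix (Fin p) (Fin p) ℝ :=
  Matrix.of fun i j => (1 / (n : ℝ)) * ∑ k, x k i * x k j

/-- Hard thresholding of all entries: `M_ij 1{|M_ij| > τ}`. -/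
def thresholdAll {p : ℕ} (τ : ℝ) (M : Matrix (Fin p) (Fin p) ℝ) : Matrix (Fin p) (Fin p) ℝ :=
  Matrix.of fun i j => if τ < |M i j| then M i j else 0

/-- Hard thresholding of the off-diagonal entries; the diagonal is kept as it is. -/
def thresholdOffDiag {p : ℕ} (τ : ℝ) (M : Matrix (Fin p) (Fin p) ℝ) :
    Matrix (Fin p) (Fin p) ℝ :=
  Matrix.of fun i j => if i = j then M i j else if τ < |M i j| then M i j else 0

/-- The threshold `τ = 2 C₀ √(γ log p / n)`. -/
def threshold (C₀ γ : ℝ) (n p : ℕ) : ℝ :=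
  2 * C₀ * Real.sqrt (γ * Real.log p / n)

/-- The rate: `R² log p / n` if `q < max (r - 1) 0`, and `R² (γ log p / n) ^ (r - q)` otherwise. -/
def psiRate (γ r q R : ℝ) (n p : ℕ) : ℝ :=
  if q < max (r - 1) 0 then R ^ 2 * Real.log p / n
  else R ^ 2 * (γ * Real.log p / n) ^ (r - q)

end

/-! The probability space splits according to whether every empirical entry lies within `τ / 2` of
the true one.

On the good event the argument is deterministic, row by row. A kept entry has `m` comparable to `s`,
so `|m|^r - |s|^r` is of order `|s|^(r-1) τ`; a discarded one has `|s|` of order at most `τ`. With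
`e = min 1 (r - q)`, both errors are at most a constant times `|s|^q τ^e`, and summing over a row
gives `R τ^e` (`abs_lrFunctional_threshold_sub_le`), whose square is of the order of the rate.

The bad event has probability at most `2 p^(2-2γ)`, by a Chernoff bound and a union over `p²`
entries (`measureReal_empCov_bad_le`). There the squared error is dominated by exponentials of the
sample variances (`sq_lrFunctional_threshold_sub_le`), whose moments are bounded uniformly in `n`. A
weighted AM-GM inequality then plays the role of Cauchy–Schwarz and gives the `p^(4-γ/2)` term.

Both probabilistic inputs rest on `multivariateGaussian_exp_mul`, which bounds the moment generating
function of a product of coordinates by polarization. -/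

/-! ### Exponential moments of products of Gaussian coordinates. -/

theorem exp_neg_mul_inv_sqrt_le {l : ℝ} (hl : |l| ≤ 1 / 4) :
    Real.exp (-l) * (√(1 - 2 * l))⁻¹ ≤ Real.exp (2 * l ^ 2) := by
  obtain ⟨h1, h2⟩ := abs_le.1 hl
  have hpos : 0 < 1 - 2 * l := by linarith
  -- With `y = 2l` this is `log (1 - y) ≥ -y - y²` on `|y| ≤ 1/2`. For `y ≤ 0` the linear bound on
  -- exp suffices, since `(1 + y + y²)(1 - y) = 1 - y³`; for `y ≥ 0` the quadratic term is needed.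
  have key : 1 ≤ Real.exp (2 * l + (2 * l) ^ 2) * (1 - 2 * l) := by
    obtain ⟨y, rfl⟩ : ∃ y, l = y / 2 := ⟨2 * l, by ring⟩
    rcases le_total y 0 with hy | hy
    · have := Real.add_one_le_exp (2 * (y / 2) + (2 * (y / 2)) ^ 2)
      have h3 : 0 ≤ -y ^ 3 := by nlinarith [sq_nonneg y, mul_nonneg (neg_nonneg.2 hy) (sq_nonneg y)]
      nlinarith [mul_le_mul_of_nonneg_right this hpos.le]
    · have := Real.quadratic_le_exp_of_nonneg (x := 2 * (y / 2) + (2 * (y / 2)) ^ 2) (by positivity)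
      refine le_trans ?_ (mul_le_mul_of_nonneg_right this hpos.le)
      have h4 : 0 ≤ y ^ 2 * ((1 + y) * (1 - y ^ 2) / 2 - y) := by
        apply mul_nonneg (sq_nonneg y)
        have h5 : 0 ≤ (1 + y) * (1 / 4 - y ^ 2) := mul_nonneg (by linarith) (by nlinarith)
        nlinarith
      nlinarith
  have h3 : Real.exp (-(l + 2 * l ^ 2)) ≤ √(1 - 2 * l) := by
    apply Real.le_sqrt_of_sq_le
    rw [← Real.exp_nat_mul, ← mul_le_mul_iff_right₀ (Real.exp_pos (2 * l + (2 * l) ^ 2)),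
      ← Real.exp_add]
    refine le_trans (le_of_eq ?_) key
    rw [Real.exp_eq_one_iff]; push_cast; ring
  rw [← div_eq_mul_inv, div_le_iff₀ (Real.sqrt_pos.2 hpos)]
  calc Real.exp (-l) = Real.exp (2 * l ^ 2) * Real.exp (-(l + 2 * l ^ 2)) := by
        rw [← Real.exp_add]; ring_nf
    _ ≤ _ := by gcongr

theorem gaussianReal_exp_sq {v : NNReal} (hv : v ≠ 0) {l : ℝ} (hl : |l| ≤ 1 / 4) :
    Integrable (fun x => Real.exp (l * (x ^ 2 / v - 1))) (gaussianReal 0 v) ∧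
      ∫ x, Real.exp (l * (x ^ 2 / v - 1)) ∂(gaussianReal 0 v) ≤ Real.exp (2 * l ^ 2) := by
  have hv0 : (0 : ℝ) < v := by positivity
  obtain ⟨h1, h2⟩ := abs_le.1 hl
  have hpos : 0 < 1 - 2 * l := by linarith
  set b : ℝ := (1 - 2 * l) / (2 * v) with hb
  have hb0 : 0 < b := by positivity
  have hpdf : ∀ x, gaussianPDFReal 0 v x * Real.exp (l * (x ^ 2 / v - 1)) =
      ((√(2 * Real.pi * v))⁻¹ * Real.exp (-l)) * Real.exp (-b * x ^ 2) := by
    intro x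
    rw [gaussianPDFReal_def]
    simp only
    rw [mul_assoc (√_)⁻¹, mul_assoc (√_)⁻¹, ← Real.exp_add, ← Real.exp_add]
    congr 2
    rw [hb]; field_simp; ring
  constructor
  · rw [gaussianReal_of_var_ne_zero _ hv, gaussianPDF_def]
    rw [integrable_withDensity_iff_integrable_smul₀' (by fun_prop) (by simp)]
    refine ((integrable_exp_neg_mul_sq hb0).const_mul
      ((√(2 * Real.pi * v))⁻¹ * Real.exp (-l))).congr (ae_of_all _ fun x => ?_)
    simp only [smul_eq_mul]
    rw [ENNReal.toReal_ofReal (gaussianPDFReal_nonneg _ _ _), hpdf]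
  · rw [integral_gaussianReal_eq_integral_smul hv]
    simp only [smul_eq_mul, hpdf]
    rw [integral_const_mul, integral_gaussian]
    refine le_trans (le_of_eq ?_) (exp_neg_mul_inv_sqrt_le hl)
    have : Real.pi / b = (2 * Real.pi * v) * (1 - 2 * l)⁻¹ := by
      rw [hb]; field_simp
    rw [this, Real.sqrt_mul (by positivity) (1 - 2 * l)⁻¹, Real.sqrt_inv]
    have : 0 < √(2 * Real.pi * v) := by positivity
    field_simp

/-- A weighted form covering degenerate Gaussians: here `x ^ 2 / 0 = 0`. -/
theorem gaussianReal_weighted_exp_sq (v : NNReal) {l : ℝ} (hl : |l| ≤ 1 / 4) :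
    Integrable (fun x => Real.exp (l * (x ^ 2 / v - 1))) (gaussianReal 0 v) ∧
      v * ∫ x, Real.exp (l * (x ^ 2 / v - 1)) ∂(gaussianReal 0 v) ≤ v * Real.exp (2 * l ^ 2) := by
  by_cases hv : v = 0
  · subst hv; simp
  · exact ⟨(gaussianReal_exp_sq hv hl).1, by gcongr; exact (gaussianReal_exp_sq hv hl).2⟩

/-- For `v = 0` the law is the Dirac mass at 0, so the default value of division by zero is
harmless. -/
theorem gaussianReal_ae_sq_div (v : NNReal) : ∀ᵐ x ∂(gaussianReal 0 v), (v : ℝ) * (x ^ 2 / v) = x ^ 2 := by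
  by_cases hv : v = 0
  · subst hv; simp [ae_dirac_eq]
  · exact ae_of_all _ fun x => by field_simp

/-- The law of `x i + s * x j` under a centred multivariate Gaussian. -/
theorem hasLaw_add_mul_multivariateGaussian {p : ℕ} {S : Matrix (Fin p) (Fin p) ℝ}
    (hS : S.PosSemidef) (i j : Fin p) (s : ℝ) :
    0 ≤ S i i + 2 * s * S i j + s ^ 2 * S j j ∧
    HasLaw (fun x : EuclideanSpace ℝ (Fin p) => x i + s * x j)
      (gaussianReal 0 (S i i + 2 * s * S i j + s ^ 2 * S j j).toNNReal)
      (multivariateGaussian 0 S) := by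
  let Lf : EuclideanSpace ℝ (Fin p) →L[ℝ] ℝ :=
    EuclideanSpace.proj i + s • EuclideanSpace.proj j
  have hL : (fun x : EuclideanSpace ℝ (Fin p) => x i + s * x j) = Lf := by
    ext x; simp [Lf]
  have hm : ∀ k : Fin p, MemLp (fun x : EuclideanSpace ℝ (Fin p) => x k) 2
      (multivariateGaussian 0 S) := fun k =>
    IsGaussian.memLp_dual _ (EuclideanSpace.proj k) 2 (by simp)
  have hvar : Var[Lf; multivariateGaussian 0 S] = S i i + 2 * s * S i j + s ^ 2 * S j j := by
    rw [← hL]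
    have := variance_add (hm i) ((hm j).const_mul s)
    simp only [Pi.add_def] at this
    rw [this, variance_const_mul, variance_eval_multivariateGaussian hS,
      variance_eval_multivariateGaussian hS, covariance_const_mul_right,
      covariance_eval_multivariateGaussian hS]
    ring
  refine ⟨hvar ▸ variance_nonneg _ _, by fun_prop, ?_⟩
  rw [hL, IsGaussian.map_eq_gaussianReal, ContinuousLinearMap.integral_comp_id_comm, hvar]
  · simp
  · exact IsGaussian.integrable_id

/-- The variances `2 ± 2 S i j` of `x i ± x j` are nonnegative. -/
theorem abs_entry_le_one_of_posSemidef {p : ℕ} {S : Matrix (Fin p) (Fin p) ℝ}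
    (hS : S.PosSemidef) (h1 : ∀ i, S i i = 1) (i j : Fin p) : |S i j| ≤ 1 := by
  have h2 := (hasLaw_add_mul_multivariateGaussian hS i j 1).1
  have h3 := (hasLaw_add_mul_multivariateGaussian hS i j (-1)).1
  rw [h1, h1] at h2 h3
  exact abs_le.2 ⟨by linarith, by linarith⟩

/-- Polarization: `4 x_i x_j = (x_i + x_j)² - (x_i - x_j)²`. The variances `a`, `b` of the sum and
difference satisfy `a/4 + b/4 = 1`, so convexity of exp reduces the claim to two one-dimensional
Gaussians and their joint law never enters. Either variance may vanish, when `S i j = ±1`. -/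
theorem multivariateGaussian_exp_mul {p : ℕ} {S : Matrix (Fin p) (Fin p) ℝ}
    (hS : S.PosSemidef) (h1 : ∀ i, S i i = 1) (i j : Fin p) {l : ℝ} (hl : |l| ≤ 1 / 4) :
    Integrable (fun x : EuclideanSpace ℝ (Fin p) => Real.exp (l * (x i * x j - S i j)))
      (multivariateGaussian 0 S) ∧
    ∫ x : EuclideanSpace ℝ (Fin p), Real.exp (l * (x i * x j - S i j)) ∂(multivariateGaussian 0 S)
      ≤ Real.exp (2 * l ^ 2) := by
  obtain ⟨ha, hU⟩ := hasLaw_add_mul_multivariateGaussian hS i j 1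
  obtain ⟨hb, hV⟩ := hasLaw_add_mul_multivariateGaussian hS i j (-1)
  obtain ⟨a, ha'⟩ : ∃ a : NNReal, (a : ℝ) = S i i + 2 * 1 * S i j + 1 ^ 2 * S j j := ⟨⟨_, ha⟩, rfl⟩
  obtain ⟨b, hb'⟩ : ∃ b : NNReal, (b : ℝ) = S i i + 2 * (-1) * S i j + (-1) ^ 2 * S j j :=
    ⟨⟨_, hb⟩, rfl⟩
  rw [← ha', Real.toNNReal_coe] at hU
  rw [← hb', Real.toNNReal_coe] at hV
  rw [h1, h1] at ha' hb'
  set μ := multivariateGaussian 0 S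
  have hl' : |-l| ≤ 1 / 4 := by rwa [abs_neg]
  obtain ⟨iU, bU⟩ := gaussianReal_weighted_exp_sq a hl
  obtain ⟨iV, bV⟩ := gaussianReal_weighted_exp_sq b hl'
  have aeU := (hU.ae_iff (p := fun x => (a : ℝ) * (x ^ 2 / a) = x ^ 2) (by
    exact measurableSet_setOfPred.1 (measurableSet_eq_fun (by fun_prop) (by fun_prop)))).2 (gaussianReal_ae_sq_div a)
  have aeV := (hV.ae_iff (p := fun x => (b : ℝ) * (x ^ 2 / b) = x ^ 2) (by
    exact measurableSet_setOfPred.1 (measurableSet_eq_fun (by fun_prop) (by fun_prop)))).2 (gaussianReal_ae_sq_div b)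
  have jU := hU.map_eq ▸ iU
  have jV := hV.map_eq ▸ iV
  rw [integrable_map_measure (by fun_prop) (by fun_prop)] at jU jV
  rw [← hU.map_eq, integral_map hU.aemeasurable (by fun_prop)] at bU
  rw [← hV.map_eq, integral_map hV.aemeasurable (by fun_prop)] at bV
  have hle : ∀ᵐ x ∂μ, Real.exp (l * (x i * x j - S i j)) ≤
      a / 4 * Real.exp (l * ((x i + 1 * x j) ^ 2 / a - 1)) +
      b / 4 * Real.exp (-l * ((x i + -1 * x j) ^ 2 / b - 1)) := by
    filter_upwards [aeU, aeV] with x hx hy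
    have hab : (a : ℝ) / 4 + b / 4 = 1 := by rw [ha', hb']; ring
    have := convexOn_exp.2 (Set.mem_univ (l * ((x i + 1 * x j) ^ 2 / a - 1)))
      (Set.mem_univ (-l * ((x i + -1 * x j) ^ 2 / b - 1))) (by positivity : (0:ℝ) ≤ a / 4)
      (by positivity : (0:ℝ) ≤ b / 4) hab
    simp only [smul_eq_mul] at this
    refine le_trans (le_of_eq ?_) this
    congr 1
    have e1 : (a : ℝ) / 4 * (l * ((x i + 1 * x j) ^ 2 / a - 1)) +
        b / 4 * (-l * ((x i + -1 * x j) ^ 2 / b - 1)) =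
        l / 4 * ((a * ((x i + 1 * x j) ^ 2 / a) - a) - (b * ((x i + -1 * x j) ^ 2 / b) - b)) := by
      ring
    rw [e1, hx, hy, ha', hb']
    ring
  have jU' := jU.const_mul ((a : ℝ) / 4)
  have jV' := jV.const_mul ((b : ℝ) / 4)
  have hint := jU'.add jV'
  have hI : Integrable (fun x : EuclideanSpace ℝ (Fin p) => Real.exp (l * (x i * x j - S i j))) μ := by
    refine hint.mono' (by fun_prop) ?_
    filter_upwards [hle] with x hx
    rw [Real.norm_eq_abs, Real.abs_exp]
    exact hx
  refine ⟨hI, (integral_mono_ae hI hint hle).trans ?_⟩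
  rw [integral_add' jU' jV', integral_const_mul, integral_const_mul]
  simp only [Function.comp_def]
  rw [neg_sq] at bV
  have : Real.exp (2 * l ^ 2) = (a * Real.exp (2 * l ^ 2) + b * Real.exp (2 * l ^ 2)) / 4 := by
    rw [ha', hb']; ring
  linarith

/-! ### Concentration of the empirical covariance. -/

theorem integrable_exp_sum_of_iIndepFun {Ω ι : Type*} [MeasurableSpace Ω] [Fintype ι]
    {P : Measure Ω} [IsProbabilityMeasure P] {Y : ι → Ω → ℝ} {t B : ℝ}
    (hind : iIndepFun Y P) (hm : ∀ k, AEMeasurable (Y k) P)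
    (hi : ∀ k, Integrable (fun ω => Real.exp (t * Y k ω)) P)
    (hB : ∀ k, ∫ ω, Real.exp (t * Y k ω) ∂P ≤ B) :
    Integrable (fun ω => Real.exp (t * ∑ k, Y k ω)) P ∧
      ∫ ω, Real.exp (t * ∑ k, Y k ω) ∂P ≤ B ^ Fintype.card ι := by
  have h := hind.mgf_sum₀ (t := t) hm Finset.univ
  have hs : mgf (∑ k, Y k) P t = ∫ ω, Real.exp (t * ∑ k, Y k ω) ∂P := by
    simp [mgf, Finset.sum_apply]
  rw [hs] at h
  refine ⟨?_, ?_⟩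
  -- A non-integrable function has Bochner integral 0, but here the integral is a product of
  -- positive factors.
  · by_contra hn
    rw [integral_undef hn] at h
    exact (Finset.prod_pos fun k _ => mgf_pos (hi k)).ne h
  · rw [h]
    refine (Finset.prod_le_prod (fun k _ => mgf_nonneg) fun k _ => hB k).trans (le_of_eq ?_)
    rw [Finset.prod_const, Finset.card_univ]

section

variable {Ω : Type*} [MeasurableSpace Ω] {P : Measure Ω} [IsProbabilityMeasure P] {n p : ℕ}
  {S : Matrix (Fin p) (Fin p) ℝ} {X : Fin n → Ω → EuclideanSpace ℝ (Fin p)}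

theorem empCov_sub_exp (hS : S.PosSemidef) (h1 : ∀ i, S i i = 1) (hn : 0 < n)
    (hX : ∀ k, HasLaw (X k) (multivariateGaussian 0 S) P) (hind : iIndepFun X P)
    (i j : Fin p) {l : ℝ} (hl : |l| ≤ 1 / 4) :
    Integrable (fun ω => Real.exp (n * l * (empCov (fun k => X k ω) i j - S i j))) P ∧
      ∫ ω, Real.exp (n * l * (empCov (fun k => X k ω) i j - S i j)) ∂P
        ≤ Real.exp (2 * n * l ^ 2) := by
  obtain ⟨hint, hle⟩ := multivariateGaussian_exp_mul hS h1 i j hl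
  have hn' : (0 : ℝ) < n := by exact_mod_cast hn
  have hX' := fun k => (hX k).aemeasurable
  have hind' := hind.comp (fun _ x => x i * x j - S i j) (fun _ => by fun_prop)
  have hm : ∀ k, AEMeasurable (fun ω => X k ω i * X k ω j - S i j) P := fun k =>
    (Measurable.comp_aemeasurable (g := fun x : EuclideanSpace ℝ (Fin p) => x i * x j - S i j)
      (by fun_prop) (hX' k))
  have key := integrable_exp_sum_of_iIndepFun (t := l) (B := Real.exp (2 * l ^ 2)) hind' hm
    (fun k => by
      have := hint
      rw [← (hX k).map_eq, integrable_map_measure (by fun_prop) (hX' k)] at this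
      exact this)
    (fun k => by
      have := hle
      rw [← (hX k).map_eq, integral_map (hX' k) (by fun_prop)] at this
      exact this)
  have he : ∀ ω, n * l * (empCov (fun k => X k ω) i j - S i j) =
      l * ∑ k, ((fun x : EuclideanSpace ℝ (Fin p) => x i * x j - S i j) ∘ X k) ω := by
    intro ω
    simp only [empCov, Matrix.of_apply, Function.comp, Finset.sum_sub_distrib, Finset.sum_const,
      Finset.card_univ, Fintype.card_fin, nsmul_eq_mul]
    field_simp
  simp only [he]
  refine ⟨key.1, key.2.trans (le_of_eq ?_)⟩
  rw [← Real.exp_nat_mul, Fintype.card_fin]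
  ring_nf

/-- The choice `l = 1 / (4n)` gives an exponential moment of fixed order, bounded independently of
`n`; it serves the crude bound on the bad event. -/
theorem empCov_exp_quarter (hS : S.PosSemidef) (h1 : ∀ i, S i i = 1) (hn : 0 < n)
    (hX : ∀ k, HasLaw (X k) (multivariateGaussian 0 S) P) (hind : iIndepFun X P) (i : Fin p) :
    Integrable (fun ω => Real.exp (empCov (fun k => X k ω) i i / 4)) P ∧
      ∫ ω, Real.exp (empCov (fun k => X k ω) i i / 4) ∂P ≤ Real.exp 1 := by
  have hn' : (1 : ℝ) ≤ n := by exact_mod_cast hn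
  have hl : |1 / (4 * n : ℝ)| ≤ 1 / 4 := by
    rw [abs_of_pos (by positivity)]
    exact one_div_le_one_div_of_le (by norm_num) (by linarith)
  obtain ⟨hint, hle⟩ := empCov_sub_exp hS h1 hn hX hind i i hl
  have he : ∀ ω, Real.exp (empCov (fun k => X k ω) i i / 4) = Real.exp (1 / 4) *
      Real.exp (n * (1 / (4 * n : ℝ)) * (empCov (fun k => X k ω) i i - S i i)) := by
    intro ω
    rw [← Real.exp_add, h1]
    congr 1
    field_simp
    ring
  simp only [he]
  refine ⟨hint.const_mul _, ?_⟩
  rw [integral_const_mul]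
  refine (mul_le_mul_of_nonneg_left hle (Real.exp_nonneg _)).trans ?_
  rw [← Real.exp_add, Real.exp_le_exp]
  have : 2 * (n : ℝ) * (1 / (4 * n)) ^ 2 = 1 / (8 * n) := by field_simp; norm_num
  rw [this]
  have : 1 / (8 * n : ℝ) ≤ 1 / 8 := one_div_le_one_div_of_le (by norm_num) (by linarith)
  linarith

theorem empCov_tail (hS : S.PosSemidef) (h1 : ∀ i, S i i = 1) (hn : 0 < n)
    (hX : ∀ k, HasLaw (X k) (multivariateGaussian 0 S) P) (hind : iIndepFun X P)
    (i j : Fin p) {t : ℝ} (ht0 : 0 ≤ t) (ht1 : t ≤ 1) :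
    P.real {ω | t ≤ |empCov (fun k => X k ω) i j - S i j|} ≤ 2 * Real.exp (-(n * t ^ 2 / 8)) := by
  set D : Ω → ℝ := fun ω => empCov (fun k => X k ω) i j - S i j
  -- `l = t / 4` minimises the Chernoff exponent `-l t + 2 l²`, with value `-t² / 8`.
  have hl : |t / 4| ≤ 1 / 4 := by rw [abs_of_nonneg (by linarith)]; linarith
  have hl' : |-(t / 4)| ≤ 1 / 4 := by rwa [abs_neg]
  obtain ⟨i1, b1⟩ := empCov_sub_exp hS h1 hn hX hind i j hl
  obtain ⟨i2, b2⟩ := empCov_sub_exp hS h1 hn hX hind i j hl'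
  have hneg : ∀ ω, n * -(t / 4) * (empCov (fun k => X k ω) i j - S i j) =
      n * (t / 4) * (-D) ω := by intro ω; simp only [Pi.neg_apply, D]; ring
  simp only [hneg] at i2 b2
  have hs : (0 : ℝ) ≤ n * (t / 4) := by positivity
  have c1 := measure_ge_le_exp_mul_mgf (X := D) t hs i1
  have c2 := measure_ge_le_exp_mul_mgf (X := -D) t hs i2
  have hfin : ∀ m : ℝ, m ≤ Real.exp (2 * n * (t / 4) ^ 2) →
      Real.exp (-(n * (t / 4)) * t) * m ≤ Real.exp (-(n * t ^ 2 / 8)) := fun m hm => by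
    refine (mul_le_mul_of_nonneg_left hm (Real.exp_nonneg _)).trans (le_of_eq ?_)
    rw [← Real.exp_add]
    ring_nf
  have d1 := c1.trans (hfin _ b1)
  have d2 := c2.trans (hfin _ (by rw [neg_sq] at b2; exact b2))
  have hsub : {ω | t ≤ |D ω|} ⊆ {ω | t ≤ D ω} ∪ {ω | t ≤ (-D) ω} := fun ω hω => by
    simpa [le_abs] using hω
  calc P.real {ω | t ≤ |D ω|} ≤ _ := measureReal_mono hsub
    _ ≤ _ := measureReal_union_le _ _
    _ ≤ _ := by linarith

end

/-! ### Deterministic error on the good event. -/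

theorem absPow_of_ne_zero {x q : ℝ} (hx : x ≠ 0) : absPow x q = |x| ^ q := if_neg hx

theorem absPow_nonneg (x q : ℝ) : 0 ≤ absPow x q := by
  unfold absPow; split_ifs <;> positivity

/-- Mean value inequality; staying away from 0 bounds the derivative even for `r < 1`. -/
theorem abs_rpow_sub_one_le {r x : ℝ} (hr : 0 < r) (h1 : 1 / 2 ≤ x) (h2 : x ≤ 2) :
    |x ^ r - 1| ≤ 2 * r * 2 ^ r * |x - 1| := by
  have := (convex_Icc (1 / 2 : ℝ) 2).norm_image_sub_le_of_norm_deriv_le (f := fun y : ℝ => y ^ r)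
    (C := 2 * r * 2 ^ r) (x := 1) (y := x)
    (fun y hy => Real.differentiableAt_rpow_const_of_ne r (by linarith [hy.1]))
    (fun y hy => ?_) ⟨by norm_num, by norm_num⟩ ⟨h1, h2⟩
  · simpa using this
  · have hy0 : 0 < y := by linarith [hy.1]
    rw [Real.deriv_rpow_const, Real.norm_of_nonneg (by positivity), Real.rpow_sub_one hy0.ne']
    have h3 : y ^ r ≤ 2 ^ r := Real.rpow_le_rpow hy0.le hy.2 hr.le
    have h4 : y⁻¹ ≤ 2 := by rw [inv_le_comm₀ hy0 two_pos]; linarith [hy.1]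
    rw [div_eq_mul_inv]
    calc r * (y ^ r * y⁻¹) ≤ r * (2 ^ r * 2) := by gcongr
      _ = _ := by ring

/-- Keeping an entry `m` close to `s` changes `|s| ^ r` by little. -/
theorem abs_rpow_sub_le_of_kept {r q s m τ : ℝ} (hq : 0 ≤ q) (hqr : q < r)
    (hs0 : s ≠ 0) (hs1 : |s| ≤ 1) (hm : |m - s| ≤ τ / 2) (hτ : τ ≤ 2 * |s|)
    (hlow : |s| ≤ 2 * |m|) :
    |(|m| ^ r - |s| ^ r)| ≤ 2 * r * 2 ^ r * (absPow s q * τ ^ (min 1 (r - q))) := by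
  set e := min 1 (r - q) with he
  have hr : 0 < r := by linarith
  have he0 : 0 < e := lt_min one_pos (by linarith)
  have he1 : e ≤ 1 := min_le_left _ _
  have he2 : e ≤ r - q := min_le_right _ _
  have hs : 0 < |s| := abs_pos.2 hs0
  have hτ0 : 0 ≤ τ := by linarith [abs_nonneg (m - s)]
  have hms : |(|m| - |s|)| ≤ τ / 2 := (abs_abs_sub_abs_le m s).trans hm
  -- Factoring out `|s|^r` leaves `x^r - 1` with `|x - 1| ≤ τ / (2|s|) ≤ 1`. Raising this last ratio
  -- to the power `e ≤ 1` only enlarges it, and `|s|^(r-e) ≤ |s|^q` because `|s| ≤ 1` and `e ≤ r -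
  -- q`.
  obtain ⟨x, hx⟩ : ∃ x, x = |m| / |s| := ⟨_, rfl⟩
  have hmx : |m| = x * |s| := by rw [hx]; field_simp
  have hx0 : 0 ≤ x := by rw [hx]; positivity
  have hx1 : 1 / 2 ≤ x := by rw [hx, le_div_iff₀ hs]; linarith
  have hx2 : x ≤ 2 := by rw [hx, div_le_iff₀ hs]; linarith [(abs_le.1 hms).2]
  have hx3 : |x - 1| ≤ τ / (2 * |s|) := by
    have : x - 1 = (|m| - |s|) / |s| := by rw [hx]; field_simp
    rw [this, abs_div, abs_abs, div_le_div_iff₀ hs (by positivity)]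
    nlinarith
  have hx4 : τ / (2 * |s|) ≤ (τ / (2 * |s|)) ^ e := by
    apply Real.self_le_rpow_of_le_one (by positivity) _ he1
    rw [div_le_one (by positivity)]; exact hτ
  have hx5 : (τ / (2 * |s|)) ^ e ≤ τ ^ e * (|s| ^ e)⁻¹ := by
    rw [← Real.inv_rpow hs.le, ← Real.mul_rpow hτ0 (by positivity), ← div_eq_mul_inv]
    gcongr
    linarith
  calc |(|m| ^ r - |s| ^ r)| = |s| ^ r * |x ^ r - 1| := by
        rw [hmx, Real.mul_rpow hx0 hs.le, ← sub_one_mul, abs_mul, mul_comm,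
          abs_of_pos (Real.rpow_pos_of_pos hs r)]
    _ ≤ |s| ^ r * (2 * r * 2 ^ r * (τ ^ e * (|s| ^ e)⁻¹)) := by
        gcongr
        refine (abs_rpow_sub_one_le hr hx1 hx2).trans ?_
        gcongr
        exact (hx3.trans hx4).trans hx5
    _ = 2 * r * 2 ^ r * (|s| ^ (r - e) * τ ^ e) := by
        rw [Real.rpow_sub hs]; ring
    _ ≤ _ := by
        rw [absPow_of_ne_zero hs0]
        gcongr ?_ * (?_ * _)
        exact Real.rpow_le_rpow_of_exponent_ge hs hs1 (by linarith)

/-- Discarding an entry contributes little when it is at most of the order of the threshold. -/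
theorem abs_rpow_le_of_killed {r q s τ : ℝ} (hqr : q < r) (hr : 0 < r)
    (hs1 : |s| ≤ 1) (hs : |s| ≤ 2 * τ) :
    |s| ^ r ≤ 2 * (absPow s q * τ ^ (min 1 (r - q))) := by
  set e := min 1 (r - q) with he
  have he0 : 0 < e := lt_min one_pos (by linarith)
  have he1 : e ≤ 1 := min_le_left _ _
  have he2 : e ≤ r - q := min_le_right _ _
  have hτ0 : 0 ≤ τ := by linarith [abs_nonneg s]
  by_cases hs0 : s = 0
  · subst hs0
    rw [abs_zero, Real.zero_rpow hr.ne']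
    simp [absPow]
  · have hsp : 0 < |s| := abs_pos.2 hs0
    rw [absPow_of_ne_zero hs0]
    calc |s| ^ r = |s| ^ q * |s| ^ (r - q) := by rw [← Real.rpow_add hsp]; ring_nf
      _ ≤ |s| ^ q * |s| ^ e := by
          gcongr ?_ * ?_
          exact Real.rpow_le_rpow_of_exponent_ge hsp hs1 he2
      _ ≤ |s| ^ q * (2 * τ) ^ e := by gcongr
      _ ≤ |s| ^ q * (2 * τ ^ e) := by
          rw [Real.mul_rpow two_pos.le hτ0]
          gcongr
          exact Real.rpow_le_self_of_one_le one_le_two he1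
      _ = _ := by ring

/-- A finite maximum is 1-Lipschitz for the sup norm. -/
theorem abs_lrFunctional_sub_le {p : ℕ} [NeZero p] {r C : ℝ} {M N : Matrix (Fin p) (Fin p) ℝ}
    (h : ∀ i, |∑ j, |M i j| ^ r - ∑ j, |N i j| ^ r| ≤ C) :
    |lrFunctional r M - lrFunctional r N| ≤ C := by
  unfold lrFunctional
  have hb : ∀ f : Fin p → ℝ, BddAbove (Set.range f) := fun f => (Set.finite_range f).bddAbove
  rw [abs_sub_le_iff]
  constructor <;> rw [sub_le_iff_le_add] <;> refine ciSup_le fun i => ?_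
  · have := le_ciSup (hb fun i => ∑ j, |N i j| ^ r) i
    linarith [(abs_le.1 (h i)).2]
  · have := le_ciSup (hb fun i => ∑ j, |M i j| ^ r) i
    linarith [(abs_le.1 (h i)).1]

/-- Both thresholding rules either keep an entry or discard it, and only keep entries that are
large or on the diagonal. -/
theorem threshold_cases {p : ℕ} {τ : ℝ} {T : Matrix (Fin p) (Fin p) ℝ → Matrix (Fin p) (Fin p) ℝ}
    (hT : T ∈ ({thresholdOffDiag τ, thresholdAll τ} :
      Set (Matrix (Fin p) (Fin p) ℝ → Matrix (Fin p) (Fin p) ℝ)))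
    (M : Matrix (Fin p) (Fin p) ℝ) (i j : Fin p) :
    (T M i j = M i j ∧ (i = j ∨ τ < |M i j|)) ∨ (T M i j = 0 ∧ |M i j| ≤ τ) := by
  rcases hT with rfl | rfl
  · simp only [thresholdOffDiag, Matrix.of_apply]
    split_ifs with h1 h2
    · exact Or.inl ⟨rfl, Or.inl h1⟩
    · exact Or.inl ⟨rfl, Or.inr h2⟩
    · exact Or.inr ⟨rfl, not_lt.1 h2⟩
  · simp only [thresholdAll, Matrix.of_apply]
    split_ifs with h2
    · exact Or.inl ⟨rfl, Or.inr h2⟩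
    · exact Or.inr ⟨rfl, not_lt.1 h2⟩

theorem measurable_lrFunctional_threshold_empCov {n p : ℕ} {τ : ℝ} (r : ℝ)
    {T : Matrix (Fin p) (Fin p) ℝ → Matrix (Fin p) (Fin p) ℝ}
    (hT : T ∈ ({thresholdOffDiag τ, thresholdAll τ} :
      Set (Matrix (Fin p) (Fin p) ℝ → Matrix (Fin p) (Fin p) ℝ))) :
    Measurable fun x : Fin n → EuclideanSpace ℝ (Fin p) => lrFunctional r (T (empCov x)) := by
  have hm : ∀ i j, Measurable fun x : Fin n → EuclideanSpace ℝ (Fin p) => empCov x i j := by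
    intro i j
    simp only [empCov, Matrix.of_apply]
    fun_prop
  have hif : ∀ i j, Measurable fun x : Fin n → EuclideanSpace ℝ (Fin p) =>
      if τ < |empCov x i j| then empCov x i j else 0 := fun i j =>
    Measurable.ite (measurableSet_lt measurable_const (hm i j).abs) (hm i j) measurable_const
  have hTm : ∀ i j, Measurable fun x : Fin n → EuclideanSpace ℝ (Fin p) => T (empCov x) i j := by
    intro i j
    rcases hT with rfl | rfl
    · simp only [thresholdOffDiag, Matrix.of_apply]
      split_ifs
      · exact hm i j
      · exact hif i j
    · exact hif i j
  unfold lrFunctional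
  exact Measurable.iSup fun i => Finset.measurable_sum _ fun j _ => (hTm i j).abs.pow_const r

/-- The error of the thresholded functional when all entries are within half the threshold. -/
theorem abs_lrFunctional_threshold_sub_le {p : ℕ} [NeZero p] {r q R τ : ℝ} (hq : 0 ≤ q)
    (hqr : q < r) (hτ0 : 0 ≤ τ) (hτ1 : τ ≤ 1) {S M : Matrix (Fin p) (Fin p) ℝ}
    (h1 : ∀ i, S i i = 1) (hS1 : ∀ i j, |S i j| ≤ 1) (hR : ∀ i, ∑ j, absPow (S i j) q ≤ R)
    {T : Matrix (Fin p) (Fin p) ℝ → Matrix (Fin p) (Fin p) ℝ}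
    (hT : T ∈ ({thresholdOffDiag τ, thresholdAll τ} :
      Set (Matrix (Fin p) (Fin p) ℝ → Matrix (Fin p) (Fin p) ℝ)))
    (hM : ∀ i j, |M i j - S i j| ≤ τ / 2) :
    |lrFunctional r (T M) - lrFunctional r S| ≤
      (2 * r * 2 ^ r + 2) * (R * τ ^ (min 1 (r - q))) := by
  have hr : 0 < r := by linarith
  refine abs_lrFunctional_sub_le fun i => ?_
  rw [← Finset.sum_sub_distrib]
  refine (Finset.abs_sum_le_sum_abs _ _).trans ?_
  have hterm : ∀ j, |(|T M i j| ^ r - |S i j| ^ r)| ≤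
      (2 * r * 2 ^ r + 2) * (absPow (S i j) q * τ ^ (min 1 (r - q))) := by
    intro j
    have hc : 0 ≤ absPow (S i j) q * τ ^ (min 1 (r - q)) :=
      mul_nonneg (absPow_nonneg _ _) (Real.rpow_nonneg hτ0 _)
    have hK : 0 ≤ 2 * r * 2 ^ r := by positivity
    have hMij := hM i j
    have hd := (abs_le.1 ((abs_abs_sub_abs_le (M i j) (S i j)).trans hMij))
    rw [add_mul]
    rcases threshold_cases hT M i j with ⟨hk, hk'⟩ | ⟨hk, hk'⟩
    · rw [hk]
      -- A diagonal entry may be kept untested, but there `s = 1` and `τ ≤ 1`. Otherwise `|s| ≥ |m|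
      -- - τ/2 > τ/2`; strictness gives `s ≠ 0` even when `τ = 0`.
      have hcases : τ ≤ 2 * |S i j| ∧ |S i j| ≤ 2 * |M i j| ∧ S i j ≠ 0 := by
        rcases hk' with rfl | hk'
        · rw [h1, abs_one] at hd ⊢
          exact ⟨by linarith, by linarith, one_ne_zero⟩
        · exact ⟨by linarith, by linarith, abs_pos.1 (by linarith)⟩
      have := abs_rpow_sub_le_of_kept hq hqr hcases.2.2 (hS1 i j) hMij hcases.1 hcases.2.1
      linarith
    · rw [hk, abs_zero, Real.zero_rpow hr.ne', zero_sub, abs_neg, abs_of_nonneg (by positivity)]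
      have := abs_rpow_le_of_killed hqr hr (hS1 i j) (τ := τ) (by linarith)
      nlinarith
  refine (Finset.sum_le_sum fun j _ => hterm j).trans ?_
  rw [← Finset.mul_sum, ← Finset.sum_mul]
  gcongr
  exact hR i

/-! ### Crude bound valid everywhere. -/

theorem empCov_self_nonneg {n p : ℕ} (x : Fin n → EuclideanSpace ℝ (Fin p)) (i : Fin p) :
    0 ≤ empCov x i i := by
  simp only [empCov, Matrix.of_apply]
  exact mul_nonneg (by positivity) (Finset.sum_nonneg fun k _ => mul_self_nonneg _)

/-- Lets exponential moments of the diagonal control every entry. -/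
theorem abs_empCov_le {n p : ℕ} (x : Fin n → EuclideanSpace ℝ (Fin p)) (i j : Fin p) :
    |empCov x i j| ≤ max (empCov x i i) (empCov x j j) := by
  have h : |empCov x i j| ≤ (empCov x i i + empCov x j j) / 2 := by
    simp only [empCov, Matrix.of_apply]
    rw [abs_mul, abs_of_nonneg (by positivity : (0:ℝ) ≤ 1 / n), ← mul_add, mul_div_assoc,
      ← Finset.sum_add_distrib, Finset.sum_div]
    gcongr
    refine (Finset.abs_sum_le_sum_abs _ _).trans (Finset.sum_le_sum fun k _ => ?_)
    rw [abs_le]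
    constructor <;> nlinarith [sq_nonneg (x k i + x k j), sq_nonneg (x k i - x k j)]
  have h1 := le_max_left (empCov x i i) (empCov x j j)
  have h2 := le_max_right (empCov x i i) (empCov x j j)
  linarith

/-- The rate 1/16 leaves room for two doublings, from squaring the error and from AM-GM, which end
at the available moment 1/4. -/
theorem rpow_le_mul_exp {r x : ℝ} (hr : 0 < r) (hx : 0 ≤ x) :
    x ^ r ≤ (16 * r) ^ r * Real.exp (x / 16) := by
  have h : x ≤ 16 * r * Real.exp (x / (16 * r)) := by
    have := Real.add_one_le_exp (x / (16 * r))
    calc x = 16 * r * (x / (16 * r)) := by field_simp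
      _ ≤ _ := by gcongr; linarith
  calc x ^ r ≤ (16 * r * Real.exp (x / (16 * r))) ^ r := by gcongr
    _ = _ := by
      rw [Real.mul_rpow (by positivity) (Real.exp_nonneg _), ← Real.exp_mul]
      congr 2
      field_simp

/-- A crude bound for the error, valid everywhere. -/
theorem sq_lrFunctional_threshold_sub_le {n p : ℕ} [NeZero p] {r τ : ℝ} (hr : 0 < r)
    {S : Matrix (Fin p) (Fin p) ℝ} (hS1 : ∀ i j, |S i j| ≤ 1)
    {T : Matrix (Fin p) (Fin p) ℝ → Matrix (Fin p) (Fin p) ℝ}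
    (hT : T ∈ ({thresholdOffDiag τ, thresholdAll τ} :
      Set (Matrix (Fin p) (Fin p) ℝ → Matrix (Fin p) (Fin p) ℝ)))
    (x : Fin n → EuclideanSpace ℝ (Fin p)) :
    (lrFunctional r (T (empCov x)) - lrFunctional r S) ^ 2 ≤
      ((16 * r) ^ r + 1) ^ 2 * (p : ℝ) ^ 3 * ∑ k, Real.exp (empCov x k k / 8) := by
  set E : ℝ := ∑ k, Real.exp (empCov x k k / 16) with hE
  set C : ℝ := (16 * r) ^ r + 1 with hC
  have hC0 : 0 ≤ (16 * r) ^ r := by positivity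
  have hle : ∀ k, Real.exp (empCov x k k / 16) ≤ E := fun k =>
    Finset.single_le_sum (f := fun k => Real.exp (empCov x k k / 16))
      (fun _ _ => Real.exp_nonneg _) (Finset.mem_univ k)
  have hE1 : 1 ≤ E := (Real.one_le_exp (by
    have := empCov_self_nonneg x (0 : Fin p); positivity)).trans (hle 0)
  have hentry : ∀ i j, |(|T (empCov x) i j| ^ r - |S i j| ^ r)| ≤ C * E := by
    intro i j
    have hT1 : |T (empCov x) i j| ≤ |empCov x i j| := by
      rcases threshold_cases hT (empCov x) i j with ⟨h, _⟩ | ⟨h, _⟩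
      · rw [h]
      · rw [h, abs_zero]; exact abs_nonneg _
    have hT2 : |T (empCov x) i j| ^ r ≤ (16 * r) ^ r * E := by
      rcases max_choice (empCov x i i) (empCov x j j) with h | h
      · have := hT1.trans ((abs_empCov_le x i j).trans_eq h)
        exact (Real.rpow_le_rpow (abs_nonneg _) this hr.le).trans
          ((rpow_le_mul_exp hr (empCov_self_nonneg x i)).trans (by gcongr; exact hle i))
      · have := hT1.trans ((abs_empCov_le x i j).trans_eq h)
        exact (Real.rpow_le_rpow (abs_nonneg _) this hr.le).trans
          ((rpow_le_mul_exp hr (empCov_self_nonneg x j)).trans (by gcongr; exact hle j))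
    have hS2 : |S i j| ^ r ≤ 1 := Real.rpow_le_one (abs_nonneg _) (hS1 i j) hr.le
    have h1 : 0 ≤ |T (empCov x) i j| ^ r := by positivity
    have h2 : 0 ≤ |S i j| ^ r := by positivity
    have h3 : 0 ≤ (16 * r) ^ r * E := by positivity
    rw [hC, add_mul, one_mul, abs_le]
    constructor <;> linarith
  have hD : |lrFunctional r (T (empCov x)) - lrFunctional r S| ≤ p * (C * E) := by
    refine abs_lrFunctional_sub_le fun i => ?_
    rw [← Finset.sum_sub_distrib]
    refine (Finset.abs_sum_le_sum_abs _ _).trans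
      ((Finset.sum_le_sum fun j _ => hentry i j).trans (le_of_eq ?_))
    simp
  have hE2 : E ^ 2 ≤ p * ∑ k, Real.exp (empCov x k k / 8) := by
    have := sq_sum_le_card_mul_sum_sq (s := Finset.univ)
      (f := fun k => Real.exp (empCov x k k / 16))
    rw [Finset.card_univ, Fintype.card_fin] at this
    refine this.trans (le_of_eq ?_)
    congr 2
    ext k
    rw [← Real.exp_nat_mul]
    congr 1
    push_cast
    ring
  calc _ = |lrFunctional r (T (empCov x)) - lrFunctional r S| ^ 2 := (sq_abs _).symm
    _ ≤ (p * (C * E)) ^ 2 := by gcongr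
    _ = C ^ 2 * p ^ 2 * E ^ 2 := by ring
    _ ≤ C ^ 2 * p ^ 2 * (p * ∑ k, Real.exp (empCov x k k / 8)) := by gcongr
    _ = _ := by ring

/-! ### Combination of the good and bad events. -/

theorem exp_eighth_le {a y : ℝ} (ha : 0 < a) :
    Real.exp (y / 8) ≤ a * Real.exp (y / 4) + a⁻¹ := by
  have h : Real.exp (y / 4) = Real.exp (y / 8) ^ 2 := by
    rw [← Real.exp_nat_mul]; congr 1; push_cast; ring
  rw [h]
  set z := Real.exp (y / 8)
  have h2 : a * z ^ 2 + a⁻¹ - z = a⁻¹ * ((a * z - 1 / 2) ^ 2 + 3 / 4) := by field_simp; ring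
  have : 0 ≤ a⁻¹ * ((a * z - 1 / 2) ^ 2 + 3 / 4) := by positivity
  linarith

/-- The squared error on the good event is of the order of the rate. -/
theorem sq_threshold_rpow_le_psiRate {C₀ γ r q R K : ℝ} {n p : ℕ} (hγ : 0 < γ) (hC₀ : 0 < C₀)
    (hq : 0 ≤ q) :
    (K * (R * threshold C₀ γ n p ^ (min 1 (r - q)))) ^ 2 ≤
      K ^ 2 * (4 * C₀ ^ 2 * γ + (4 * C₀ ^ 2) ^ (r - q)) * psiRate γ r q R n p := by
  have hL : 0 ≤ γ * Real.log p / n := by positivity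
  have hτ : 0 ≤ threshold C₀ γ n p := by unfold threshold; positivity
  have hτ2 : threshold C₀ γ n p ^ 2 = 4 * C₀ ^ 2 * (γ * Real.log p / n) := by
    rw [threshold, mul_pow, Real.sq_sqrt hL]; ring
  have hpow : (threshold C₀ γ n p ^ (min 1 (r - q))) ^ 2 =
      (4 * C₀ ^ 2 * (γ * Real.log p / n)) ^ (min 1 (r - q)) := by
    rw [← hτ2, ← Real.rpow_mul_natCast hτ, ← Real.rpow_natCast_mul hτ, mul_comm]
  rw [mul_pow, mul_pow, hpow, mul_assoc (K ^ 2)]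
  refine mul_le_mul_of_nonneg_left ?_ (sq_nonneg K)
  have h1 : 0 ≤ (4 * C₀ ^ 2) ^ (r - q) := by positivity
  -- As `q ≥ 0`, the two regimes of the rate are exactly `e = 1` with `q < r - 1`, and `e = r - q`.
  by_cases h : q < max (r - 1) 0
  · have h' : q < r - 1 := by
      rcases lt_max_iff.1 h with h | h
      · exact h
      · linarith
    rw [psiRate, if_pos h, min_eq_left (by linarith), Real.rpow_one]
    have : 0 ≤ R ^ 2 * Real.log p / n := by positivity
    calc _ = 4 * C₀ ^ 2 * γ * (R ^ 2 * Real.log p / n) := by ring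
      _ ≤ _ := by gcongr; linarith
  · have h' : r - 1 ≤ q := (le_max_left _ _).trans (not_lt.1 h)
    rw [psiRate, if_neg h, min_eq_right (by linarith), Real.mul_rpow (by positivity) hL]
    have : 0 ≤ R ^ 2 * (γ * Real.log p / n) ^ (r - q) := by positivity
    calc _ = (4 * C₀ ^ 2) ^ (r - q) * (R ^ 2 * (γ * Real.log p / n) ^ (r - q)) := by ring
      _ ≤ _ := by
        gcongr
        have : 0 ≤ 4 * C₀ ^ 2 * γ := by positivity
        linarith

/-- Some entry of the empirical covariance matrix is off by more than half the threshold only with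
small probability. -/
theorem measureReal_empCov_bad_le {Ω : Type*} [MeasurableSpace Ω] {P : Measure Ω}
    [IsProbabilityMeasure P] {n p : ℕ} {S : Matrix (Fin p) (Fin p) ℝ}
    {X : Fin n → Ω → EuclideanSpace ℝ (Fin p)} {C₀ γ : ℝ} (hγ : 0 ≤ γ) (hC₀ : 4 ≤ C₀)
    (hp : 0 < p) (hτ1 : threshold C₀ γ n p ≤ 1)
    (hS : S.PosSemidef) (h1 : ∀ i, S i i = 1) (hn : 0 < n)
    (hX : ∀ k, HasLaw (X k) (multivariateGaussian 0 S) P) (hind : iIndepFun X P) :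
    P.real {ω | ∃ i j, threshold C₀ γ n p / 2 < |empCov (fun k => X k ω) i j - S i j|} ≤
      2 * (p : ℝ) ^ (2 - 2 * γ) := by
  have hp' : (0 : ℝ) < p := by exact_mod_cast hp
  have hn' : (0 : ℝ) < n := by exact_mod_cast hn
  set t := threshold C₀ γ n p / 2 with ht
  have hlog : 0 ≤ Real.log p := Real.log_natCast_nonneg p
  have hL : 0 ≤ γ * Real.log p / n := by positivity
  have ht0 : 0 ≤ t := by rw [ht, threshold]; positivity
  have hexp : Real.exp (-(n * t ^ 2 / 8)) ≤ (p : ℝ) ^ (-(2 * γ)) := by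
    rw [Real.rpow_def_of_pos hp', Real.exp_le_exp]
    have : n * t ^ 2 = C₀ ^ 2 * (γ * Real.log p) := by
      rw [ht, threshold, div_pow, mul_pow, Real.sq_sqrt hL]; field_simp
    rw [this]
    -- Here `C₀ ≥ 4` enters: `16 / 8 = 2` is the factor in the exponent `2γ`.
    have h16 : 16 ≤ C₀ ^ 2 := by nlinarith
    have := mul_le_mul_of_nonneg_right h16 (mul_nonneg hγ hlog)
    nlinarith
  have hsub : {ω | ∃ i j, t < |empCov (fun k => X k ω) i j - S i j|} ⊆
      ⋃ i, ⋃ j, {ω | t ≤ |empCov (fun k => X k ω) i j - S i j|} := by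
    rintro ω ⟨i, j, h⟩
    exact Set.mem_iUnion.2 ⟨i, Set.mem_iUnion.2 ⟨j, h.le⟩⟩
  calc _ ≤ _ := measureReal_mono hsub
    _ ≤ ∑ i : Fin p, ∑ j : Fin p, P.real {ω | t ≤ |empCov (fun k => X k ω) i j - S i j|} :=
        (measureReal_iUnion_fintype_le _).trans
          (Finset.sum_le_sum fun i _ => measureReal_iUnion_fintype_le _)
    _ ≤ ∑ i : Fin p, ∑ j : Fin p, 2 * (p : ℝ) ^ (-(2 * γ)) := by
        gcongr with i _ j _
        refine (empCov_tail hS h1 hn hX hind i j ht0 (by linarith)).trans ?_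
        gcongr
    _ = _ := by
        have : (p : ℝ) ^ (2 - 2 * γ) = p ^ 2 * (p : ℝ) ^ (-(2 * γ)) := by
          rw [sub_eq_add_neg, Real.rpow_add hp', Real.rpow_two]
        rw [this]
        simp only [Finset.sum_const, Finset.card_univ, Fintype.card_fin, nsmul_eq_mul]
        ring

theorem integral_sq_lrFunctional_threshold_le {Ω : Type*} [MeasurableSpace Ω] {P : Measure Ω}
    [IsProbabilityMeasure P] {n p : ℕ} {S : Matrix (Fin p) (Fin p) ℝ}
    {X : Fin n → Ω → EuclideanSpace ℝ (Fin p)} {C₀ γ r q R : ℝ} (hγ : 2 ≤ γ) (hC₀ : 4 ≤ C₀)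
    (hq : 0 ≤ q) (hqr : q < r) (hp : 0 < p) (hτ1 : threshold C₀ γ n p ≤ 1)
    (hS : S ∈ covClassG p q R) (hn : 0 < n)
    (hX : ∀ k, HasLaw (X k) (multivariateGaussian 0 S) P) (hind : iIndepFun X P)
    {T : Matrix (Fin p) (Fin p) ℝ → Matrix (Fin p) (Fin p) ℝ}
    (hT : T ∈ ({thresholdOffDiag (threshold C₀ γ n p), thresholdAll (threshold C₀ γ n p)} :
      Set (Matrix (Fin p) (Fin p) ℝ → Matrix (Fin p) (Fin p) ℝ))) :
    Integrable (fun ω =>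
      (lrFunctional r (T (empCov fun k => X k ω)) - lrFunctional r S) ^ 2) P ∧
    ∫ ω, (lrFunctional r (T (empCov fun k => X k ω)) - lrFunctional r S) ^ 2 ∂P ≤
      (2 * r * 2 ^ r + 2) ^ 2 * (4 * C₀ ^ 2 * γ + (4 * C₀ ^ 2) ^ (r - q)) * psiRate γ r q R n p +
      ((16 * r) ^ r + 1) ^ 2 * (Real.exp 1 + 2) * (p : ℝ) ^ (4 - γ / 2) := by
  obtain ⟨hpsd, hrow, h1⟩ := hS
  have hr : 0 < r := by linarith
  have : NeZero p := ⟨hp.ne'⟩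
  have hp' : (0 : ℝ) < p := by exact_mod_cast hp
  have hp1 : (1 : ℝ) ≤ p := by exact_mod_cast hp
  set τ := threshold C₀ γ n p with hτdef
  have hτ0 : 0 ≤ τ := by rw [hτdef, threshold]; positivity
  have hS1 := abs_entry_le_one_of_posSemidef hpsd h1
  set M : Ω → Matrix (Fin p) (Fin p) ℝ := fun ω => empCov fun k => X k ω with hM
  set D : Ω → ℝ := fun ω => (lrFunctional r (T (M ω)) - lrFunctional r S) ^ 2 with hD
  set A : ℝ := (2 * r * 2 ^ r + 2) ^ 2 * (4 * C₀ ^ 2 * γ + (4 * C₀ ^ 2) ^ (r - q)) *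
    psiRate γ r q R n p with hA
  set K : ℝ := (16 * r) ^ r + 1 with hK
  -- The AM-GM weight balances the two terms: `P(bad) ≤ 2a²`, so `a` times the exponential moment
  -- and `a⁻¹ P(bad)` are both of order `a`.
  set a : ℝ := (p : ℝ) ^ (1 - γ) with ha
  have ha0 : 0 < a := by positivity
  set bad : Set Ω := {ω | ∃ i j, τ / 2 < |M ω i j - S i j|} with hbad
  have hXm : AEMeasurable (fun ω k => X k ω) P := aemeasurable_pi_iff.2 fun k => (hX k).aemeasurable
  have hMm : ∀ i j, AEMeasurable (fun ω => M ω i j) P := fun i j => by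
    have h : Measurable fun x : Fin n → EuclideanSpace ℝ (Fin p) => empCov x i j := by
      simp only [empCov, Matrix.of_apply]
      fun_prop
    exact h.comp_aemeasurable hXm
  have hbadm : NullMeasurableSet bad P := by
    have : bad = ⋃ i, ⋃ j, {ω | τ / 2 < |M ω i j - S i j|} := by ext; simp [hbad]
    rw [this]
    exact .iUnion fun i => .iUnion fun j =>
      nullMeasurableSet_lt aemeasurable_const ((hMm i j).sub_const _).abs
  have hDm : AEMeasurable D P :=
    (((measurable_lrFunctional_threshold_empCov r hT).comp_aemeasurable hXm).sub_const _).pow_const 2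
  have hquarter := fun k => empCov_exp_quarter hpsd h1 hn hX hind k
  have hA0 : 0 ≤ A := (sq_nonneg _).trans
    (sq_threshold_rpow_le_psiRate (K := 2 * r * 2 ^ r + 2) (by linarith) (by linarith) hq)
  -- One integrable majorant for both events. Only the `a⁻¹` term needs the indicator, the
  -- exponential term being small in mean everywhere.
  set G : Ω → ℝ := fun ω => A + K ^ 2 * p ^ 3 *
    ∑ k, (a * Real.exp (M ω k k / 4) + a⁻¹ * bad.indicator 1 ω) with hG
  have hDG : ∀ ω, D ω ≤ G ω := by
    intro ω
    by_cases hω : ω ∈ bad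
    · have hcrude := sq_lrFunctional_threshold_sub_le hr hS1 hT (fun k => X k ω)
      refine hcrude.trans ((le_add_of_nonneg_left hA0).trans' ?_)
      simp only [Set.indicator_of_mem hω, Pi.one_apply, mul_one]
      gcongr with k _
      exact exp_eighth_le ha0
    · have hgood : ∀ i j, |M ω i j - S i j| ≤ τ / 2 := by
        simpa [hbad] using hω
      have h := abs_lrFunctional_threshold_sub_le hq hqr hτ0 hτ1 h1 hS1 hrow hT hgood
      have h2 : D ω ≤ A := by
        refine le_trans ?_ (sq_threshold_rpow_le_psiRate (by linarith) (by linarith) hq)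
        exact (sq_abs _).symm.trans_le (pow_le_pow_left₀ (abs_nonneg _) h 2)
      refine h2.trans (le_add_of_nonneg_right ?_)
      have : 0 ≤ bad.indicator (1 : Ω → ℝ) ω := Set.indicator_nonneg (fun _ _ => zero_le_one) _
      positivity
  have hind1 : Integrable (bad.indicator (1 : Ω → ℝ)) P :=
    (integrable_const (1 : ℝ)).indicator₀ hbadm
  have hsum : ∀ k, Integrable
      (fun ω => a * Real.exp (M ω k k / 4) + a⁻¹ * bad.indicator 1 ω) P := fun k =>
    ((hquarter k).1.const_mul a).add (hind1.const_mul _)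
  have hGi : Integrable G P :=
    (integrable_const A).add ((integrable_finsetSum _ fun k _ => hsum k).const_mul _)
  have hDi : Integrable D P := by
    refine hGi.mono' hDm.aestronglyMeasurable (ae_of_all _ fun ω => ?_)
    rw [Real.norm_of_nonneg (sq_nonneg _)]
    exact hDG ω
  refine ⟨hDi, (integral_mono hDi hGi hDG).trans ?_⟩
  have hbadP : a⁻¹ * P.real bad ≤ 2 * a := by
    have h := measureReal_empCov_bad_le (by linarith) hC₀ hp hτ1 hpsd h1 hn hX hind
    have h3 : (p : ℝ) ^ (2 - 2 * γ) = a * a := by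
      rw [ha, ← Real.rpow_add hp']; ring_nf
    rw [h3] at h
    calc a⁻¹ * P.real bad ≤ a⁻¹ * (2 * (a * a)) := by gcongr
      _ = _ := by field_simp
  have hterm : ∀ k, ∫ ω, (a * Real.exp (M ω k k / 4) + a⁻¹ * bad.indicator 1 ω) ∂P ≤
      (Real.exp 1 + 2) * a := by
    intro k
    rw [integral_add ((hquarter k).1.const_mul a) (hind1.const_mul _), integral_const_mul,
      integral_const_mul, integral_indicator₀ hbadm]
    have : ∫ ω in bad, (1 : Ω → ℝ) ω ∂P = P.real bad := by simp
    rw [this]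
    have := mul_le_mul_of_nonneg_left (hquarter k).2 ha0.le
    linarith
  clear_value A
  rw [hG, integral_add (integrable_const A)
    ((integrable_finsetSum _ fun k _ => hsum k).const_mul _), integral_const_mul,
    integral_finsetSum _ fun k _ => hsum k]
  simp only [integral_const, probReal_univ, one_smul]
  refine add_le_add_right ?_ A
  calc K ^ 2 * (p : ℝ) ^ 3 * ∑ k, ∫ ω, (a * Real.exp (M ω k k / 4) + a⁻¹ * bad.indicator 1 ω) ∂P
      ≤ K ^ 2 * (p : ℝ) ^ 3 * ∑ k : Fin p, (Real.exp 1 + 2) * a := by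
        gcongr with k _
        exact hterm k
    _ = K ^ 2 * (Real.exp 1 + 2) * ((p : ℝ) ^ 4 * a) := by
        simp only [Finset.sum_const, Finset.card_univ, Fintype.card_fin, nsmul_eq_mul]
        ring
    -- `p^4 a = p^(5-γ)`, and `5 - γ ≤ 4 - γ/2` is `γ ≥ 2`.
    _ ≤ _ := by
        gcongr
        rw [ha, ← Real.rpow_natCast, ← Real.rpow_add hp']
        exact Real.rpow_le_rpow_of_exponent_le hp1 (by push_cast; linarith)

theorem theorem4p2 (γ C₀ r q : ℝ) (hγ : 8 < γ) (hC₀ : 4 ≤ C₀) (hq : 0 ≤ q) (hqr : q < r) :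
    ∃ C₅ C₆ : ℝ, 0 < C₅ ∧ 0 < C₆ ∧
      ∀ (n p : ℕ), 1 ≤ p → γ * Real.log p < n → threshold C₀ γ n p ≤ 1 →
      ∀ (R : ℝ), 0 < R →
      ∀ S ∈ covClassG p q R,
      ∀ (Ω : Type*) [MeasurableSpace Ω] (P : Measure Ω) [IsProbabilityMeasure P]
        (X : Fin n → Ω → EuclideanSpace ℝ (Fin p)),
        (∀ k, HasLaw (X k) (multivariateGaussian 0 S) P) → iIndepFun X P →
        ∀ T ∈ ({thresholdOffDiag (threshold C₀ γ n p), thresholdAll (threshold C₀ γ n p)} :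
            Set (Matrix (Fin p) (Fin p) ℝ → Matrix (Fin p) (Fin p) ℝ)),
          Integrable (fun ω =>
            (lrFunctional r (T (empCov fun k => X k ω)) - lrFunctional r S) ^ 2) P ∧
          ∫ ω, (lrFunctional r (T (empCov fun k => X k ω)) - lrFunctional r S) ^ 2 ∂P
            ≤ C₅ * psiRate γ r q R n p + C₆ * (p : ℝ) ^ (4 - γ / 2) := by
  have hr : 0 < r := by linarith
  refine ⟨(2 * r * 2 ^ r + 2) ^ 2 * (4 * C₀ ^ 2 * γ + (4 * C₀ ^ 2) ^ (r - q)),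
    ((16 * r) ^ r + 1) ^ 2 * (Real.exp 1 + 2), by positivity, by positivity, ?_⟩
  intro n p hp hn hτ R _ S hS Ω _ P _ X hX hind T hT
  have hn0 : 0 < n := by
    have h : 0 ≤ γ * Real.log p := mul_nonneg (by linarith) (Real.log_natCast_nonneg p)
    exact_mod_cast h.trans_lt hn
  exact integral_sq_lrFunctional_threshold_le (by linarith) hC₀ hq hqr hp hτ hS hn0 hX hind hT
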